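/- Let $S$ be a finite set of points in the Euclidean plane and let $T$ be a minimum spanning tree of $S$, that is, a spanning tree of the complete graph on $S$ of least weight, where the weight $w$ of a graph is the sum of the Euclidean lengths of its edges. When $T$ is rooted at a vertex $r$, the children of a vertex $v$ are its neighbours that are one step further from $r$ than $v$. For each $v$ let $P_v$ be a shortest path among the paths that start at $v$ and visit every child of $v$ exactly once, and no other point ($P_v$ is just $v$ if $v$ has no children). (1) For every choice of the root, and every vertex $v$ with at most four children $v_1,\dots,v_k$ ($0\le k\le 4$), every such shortest path satisfies $$w(P_v)\le 1.5\sum_{i=1}^{k}|vv_i|.$$ (2) Suppose that every vertex of $T$ has degree at most $5$, and root $T$ at any leaf (a vertex of degree at most $1$, so that the only vertex of a one-point tree counts as a leaf). Then every vertex has at most four children, a shortest path $P_v$ exists for every $v$, and for every choice of shortest paths $P_v$ ($v\in S$) the union $T_3$ of these paths is a spanning tree of $S$ in which every vertex has degree at most $3$, and $$w(T_3)\le 1.5\,w(T).$$ -/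

import Mathlib

/-- The total length of a graph whose vertices lie in a metric space: the sum of the lengths of its
edges. -/
noncomputable def graphWeight {V : Type*} [Fintype V] [MetricSpace V] (G : SimpleGraph V) : ℝ :=
  open Classical in
  ∑ e ∈ G.edgeFinset, Sym2.lift ⟨fun u v : V => dist u v, fun u v => dist_comm u v⟩ e

/-- `T` is a minimum spanning tree of the complete graph on `V`, weighted by distance. -/
def IsMinSpanningTree {V : Type*} [Fintype V] [MetricSpace V] (T : SimpleGraph V) : Prop :=
  T.IsTree ∧ ∀ T' : SimpleGraph V, T'.IsTree → graphWeight T ≤ graphWeight T'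

/-- The children of `v` in the tree `T` rooted at `r`: the neighbours of `v` that are one step
further away from the root than `v`. -/
noncomputable def children {V : Type*} [Fintype V] (T : SimpleGraph V) (r v : V) : Finset V :=
  open Classical in
  Finset.univ.filter fun w => T.Adj v w ∧ T.dist r w = T.dist r v + 1

/-- The length of the polygonal path through the points of a list, in the order of the list. -/
noncomputable def pathWeight {V : Type*} [MetricSpace V] : List V → ℝ
  | [] => 0
  | [_] => 0
  | u :: v :: l => dist u v + pathWeight (v :: l)

/-- The path `v :: l` starts at `v` and then visits every element of `C` exactly once (and no
other point). -/
def IsPathVisiting {V : Type*} (v : V) (C : Finset V) (l : List V) : Prop :=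
  (v :: l).Nodup ∧ ∀ w, w ∈ l ↔ w ∈ C

/-- The path `v :: l` is a shortest one among the paths that start at `v` and visit `C`. -/
def IsShortestPathVisiting {V : Type*} [MetricSpace V] (v : V) (C : Finset V) (l : List V) :
    Prop :=
  IsPathVisiting v C l ∧
    ∀ l' : List V, IsPathVisiting v C l' → pathWeight (v :: l) ≤ pathWeight (v :: l')

/-- The union of the paths `v :: P v` over all vertices `v`: two vertices are adjacent when they
are consecutive on one of the paths. -/
def unionOfPaths {V : Type*} (P : V → List V) : SimpleGraph V :=
  SimpleGraph.fromRel fun a b => ∃ v, [a, b] <:+: v :: P v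

/-! ### Short paths through at most four vectors in an inner product space. -/

section Geometry

variable {E : Type*} [NormedAddCommGroup E]

/-! Each star formed by a vertex and its children is replaced by a path. With the vertex as origin,
the length of a shortest path is at most any weighted average over visiting orders, and suitable
averages cost at most 3/2 of the star (`exists_short_path_three`, `exists_short_path_four`). Far
children are pulled radially onto a sphere, which reduces the estimate to vectors in the unit ball.
There each length is bounded by a quadratic tangent to it at a guessed value `s`, so that only inner
products and the norm of the sum of three unit vectors remain.

Globally, every vertex lies on its own path, as its start, and on at most one other, its parent's;
hence degree at most 1 + 2. The union joins each vertex to its parent and has no more edges than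
`T`, so it is a tree. Summing the local bounds over the stars, which share no edges, gives the
weight bound. -/

theorem norm_le_sq_div_add_div_two {x : E} {s : ℝ} (hs : 0 < s) :
    ‖x‖ ≤ (‖x‖ ^ 2 / s + s) / 2 := by
  have h : ‖x‖ ^ 2 / s + s - 2 * ‖x‖ = (‖x‖ - s) ^ 2 / s := by field_simp; ring
  have : 0 ≤ (‖x‖ - s) ^ 2 / s := by positivity
  linarith

theorem exists_eq_norm_smul_unit [NormedSpace ℝ E] {x : E} (hx : 0 < ‖x‖) :
    ∃ u : E, ‖u‖ = 1 ∧ x = ‖x‖ • u := by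
  refine ⟨‖x‖⁻¹ • x, ?_, ?_⟩
  · rw [norm_smul, norm_inv, norm_norm, inv_mul_cancel₀ hx.ne']
  · rw [smul_smul, mul_inv_cancel₀ hx.ne', one_smul]

/-- Pulling both endpoints radially in to radius `R` shortens a segment by at most the distances
they move. -/
theorem norm_smul_sub_smul_unit_le [NormedSpace ℝ E] {R C D : ℝ} {u v : E} (hR : 0 ≤ R)
    (hC : R ≤ C) (hD : R ≤ D) (hu : ‖u‖ ≤ 1) (hv : ‖v‖ ≤ 1) :
    ‖C • u - D • v‖ ≤ R * ‖u - v‖ + (C - R) + (D - R) := by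
  have h : C • u - D • v = R • (u - v) + (C - R) • u - (D - R) • v := by module
  rw [h]
  refine (norm_sub_le _ _).trans (add_le_add ((norm_add_le _ _).trans (add_le_add ?_ ?_)) ?_)
  · rw [norm_smul, Real.norm_of_nonneg hR]
  · rw [norm_smul, Real.norm_of_nonneg (by linarith)]
    exact mul_le_of_le_one_right (by linarith) hu
  · rw [norm_smul, Real.norm_of_nonneg (by linarith)]
    exact mul_le_of_le_one_right (by linarith) hv

variable [InnerProductSpace ℝ E]

/-- Sum of the squared side lengths of a triangle inscribed in the unit sphere. -/
theorem sum_sq_norm_sub_unit {b c d : E} (hb : ‖b‖ = 1) (hc : ‖c‖ = 1) (hd : ‖d‖ = 1) :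
    ‖b - c‖ ^ 2 + ‖c - d‖ ^ 2 + ‖b - d‖ ^ 2 = 9 - ‖b + c + d‖ ^ 2 := by
  have h : ‖b + c + d‖ ^ 2 = ‖b + c‖ ^ 2 + 2 * (inner ℝ b d + inner ℝ c d) + ‖d‖ ^ 2 := by
    rw [norm_add_sq_real, inner_add_left]
  rw [h, norm_add_sq_real, norm_sub_sq_real, norm_sub_sq_real, norm_sub_sq_real, hb, hc, hd]
  ring

theorem perimeter_unit_le {b c d : E} (hb : ‖b‖ = 1) (hc : ‖c‖ = 1) (hd : ‖d‖ = 1) :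
    ‖b - c‖ + ‖c - d‖ + ‖b - d‖ ≤ 2 / 7 * (9 - ‖b + c + d‖ ^ 2) + 21 / 8 := by
  have h := sum_sq_norm_sub_unit hb hc hd
  -- 7/4 approximates √3, the side of the inscribed equilateral triangle, where the perimeter is
  -- greatest.
  have h₁ := norm_le_sq_div_add_div_two (x := b - c) (s := 7 / 4) (by norm_num)
  have h₂ := norm_le_sq_div_add_div_two (x := c - d) (s := 7 / 4) (by norm_num)
  have h₃ := norm_le_sq_div_add_div_two (x := b - d) (s := 7 / 4) (by norm_num)
  linarith

/-- Among two averages of lengths of paths from the origin through four points, of which three are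
on the unit sphere and one is in the unit ball, one is small. -/
theorem path_average_unit_le {a b c d : E} (ha : ‖a‖ ≤ 1) (hb : ‖b‖ = 1) (hc : ‖c‖ = 1)
    (hd : ‖d‖ = 1) :
    ‖a‖ + 2 / 3 * ‖a - b‖ + (‖a - c‖ + ‖a - d‖) / 6 + 2 / 3 * (‖b - c‖ + ‖c - d‖ + ‖b - d‖) ≤
        3 / 2 * (‖a‖ + 3) ∨
      (‖a‖ + 1) / 2 + (‖a - b‖ + ‖a - c‖ + ‖a - d‖) / 2 + (‖b - c‖ + ‖c - d‖ + ‖b - d‖) / 2 ≤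
        3 / 2 * (‖a‖ + 3) := by
  have hp := perimeter_unit_le hb hc hd
  have hab : ‖a - b‖ ^ 2 = ‖a‖ ^ 2 - 2 * inner ℝ a b + 1 := by rw [norm_sub_sq_real, hb]; ring
  have hac : ‖a - c‖ ^ 2 = ‖a‖ ^ 2 - 2 * inner ℝ a c + 1 := by rw [norm_sub_sq_real, hc]; ring
  have had : ‖a - d‖ ^ 2 = ‖a‖ ^ 2 - 2 * inner ℝ a d + 1 := by rw [norm_sub_sq_real, hd]; ring
  have hs : -(‖a‖ * ‖b + c + d‖) ≤ inner ℝ a b + inner ℝ a c + inner ℝ a d := by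
    rw [← inner_add_right, ← inner_add_right]
    exact neg_le_of_abs_le (abs_real_inner_le_norm a (b + c + d))
  have hi : -‖a‖ ≤ inner ℝ a b := by
    have := neg_le_of_abs_le (abs_real_inner_le_norm a b)
    rwa [hb, mul_one] at this
  have h0 : 0 ≤ ‖a‖ := norm_nonneg a
  generalize ‖b + c + d‖ = σ at *
  -- If `a` is near the origin, visiting it first is cheap and its distances to the sphere are near
  -- 1; otherwise half the weight goes to orders starting at `b`, with tangent point 4/3.
  rcases le_total ‖a‖ (1 / 4) with ht | ht
  · left
    have h₁ := norm_le_sq_div_add_div_two (x := a - b) one_pos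
    have h₂ := norm_le_sq_div_add_div_two (x := a - c) one_pos
    have h₃ := norm_le_sq_div_add_div_two (x := a - d) one_pos
    rw [hab] at h₁
    rw [hac] at h₂
    rw [had] at h₃
    -- The bound is a concave quadratic in `σ`, maximal at `σ = 7/16 * ‖a‖`.
    nlinarith [sq_nonneg (7 / 16 * ‖a‖ - σ), mul_nonneg h0 (sub_nonneg.2 ht)]
  · right
    have h₁ := norm_le_sq_div_add_div_two (x := a - b) (s := 4 / 3) (by norm_num)
    have h₂ := norm_le_sq_div_add_div_two (x := a - c) (s := 4 / 3) (by norm_num)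
    have h₃ := norm_le_sq_div_add_div_two (x := a - d) (s := 4 / 3) (by norm_num)
    rw [hab] at h₁
    rw [hac] at h₂
    rw [had] at h₃
    -- After maximising over `σ`, a convex quadratic in `‖a‖` remains, negative at both 1/4 and 1.
    nlinarith [sq_nonneg (21 / 16 * ‖a‖ - σ), mul_nonneg (sub_nonneg.2 ht) (sub_nonneg.2 ha)]

theorem exists_short_path_three {a b c : E} (ha : 0 < ‖a‖) (hab : ‖a‖ ≤ ‖b‖) (hbc : ‖b‖ ≤ ‖c‖) :
    ‖a‖ + ‖a - b‖ + ‖b - c‖ ≤ 3 / 2 * (‖a‖ + ‖b‖ + ‖c‖) ∨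
      ‖a‖ + ‖a - c‖ + ‖b - c‖ ≤ 3 / 2 * (‖a‖ + ‖b‖ + ‖c‖) ∨
      ‖b‖ + ‖a - b‖ + ‖a - c‖ ≤ 3 / 2 * (‖a‖ + ‖b‖ + ‖c‖) := by
  obtain ⟨u, hu, hau⟩ := exists_eq_norm_smul_unit ha
  obtain ⟨v, hv, hbv⟩ := exists_eq_norm_smul_unit (ha.trans_le hab)
  obtain ⟨w, hw, hcw⟩ := exists_eq_norm_smul_unit (ha.trans_le (hab.trans hbc))
  generalize ‖a‖ = A at *
  generalize ‖b‖ = B at *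
  generalize ‖c‖ = C at *
  have h₁ := norm_smul_sub_smul_unit_le ha.le le_rfl hab hu.le hv.le
  have h₂ := norm_smul_sub_smul_unit_le ha.le hab (hab.trans hbc) hv.le hw.le
  have h₃ := norm_smul_sub_smul_unit_le ha.le le_rfl (hab.trans hbc) hu.le hw.le
  rw [← hau, ← hbv] at h₁
  rw [← hbv, ← hcw] at h₂
  rw [← hau, ← hcw] at h₃
  have hp : A * (‖u - v‖ + ‖v - w‖ + ‖u - w‖) ≤ A * (2 / 7 * 9 + 21 / 8) :=
    mul_le_mul_of_nonneg_left
      ((perimeter_unit_le hu hv hw).trans (by nlinarith [sq_nonneg ‖u + v + w‖])) ha.le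
  -- The equal average of the three orders suffices: it contains 2/3 of the perimeter. The excess of
  -- `B` over `A` costs 5/3 and that of `C` only 4/3, which balances since `B ≤ C`.
  by_contra! h
  linarith [h.1, h.2.1, h.2.2]

theorem exists_short_path_four {a b c d : E} (ha : 0 < ‖a‖) (hab : ‖a‖ ≤ ‖b‖) (hbc : ‖b‖ ≤ ‖c‖)
    (hbd : ‖b‖ ≤ ‖d‖) :
    ‖a‖ + ‖a - b‖ + ‖b - c‖ + ‖c - d‖ ≤ 3 / 2 * (‖a‖ + ‖b‖ + ‖c‖ + ‖d‖) ∨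
      ‖a‖ + ‖a - b‖ + ‖b - d‖ + ‖c - d‖ ≤ 3 / 2 * (‖a‖ + ‖b‖ + ‖c‖ + ‖d‖) ∨
      ‖a‖ + ‖a - c‖ + ‖b - c‖ + ‖b - d‖ ≤ 3 / 2 * (‖a‖ + ‖b‖ + ‖c‖ + ‖d‖) ∨
      ‖a‖ + ‖a - d‖ + ‖b - d‖ + ‖b - c‖ ≤ 3 / 2 * (‖a‖ + ‖b‖ + ‖c‖ + ‖d‖) ∨
      ‖b‖ + ‖a - b‖ + ‖a - c‖ + ‖c - d‖ ≤ 3 / 2 * (‖a‖ + ‖b‖ + ‖c‖ + ‖d‖) ∨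
      ‖b‖ + ‖a - b‖ + ‖a - d‖ + ‖c - d‖ ≤ 3 / 2 * (‖a‖ + ‖b‖ + ‖c‖ + ‖d‖) := by
  -- The sphere has the second smallest radius: `c` and `d` are pulled in, while `a` stays inside
  -- the ball.
  have hR : 0 < ‖b‖ := ha.trans_le hab
  obtain ⟨v, hv, hbv⟩ := exists_eq_norm_smul_unit hR
  obtain ⟨w, hw, hcw⟩ := exists_eq_norm_smul_unit (hR.trans_le hbc)
  obtain ⟨x, hx, hdx⟩ := exists_eq_norm_smul_unit (hR.trans_le hbd)
  obtain ⟨u, hu⟩ : ∃ u : E, a = ‖b‖ • u :=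
    ⟨‖b‖⁻¹ • a, by rw [smul_smul, mul_inv_cancel₀ hR.ne', one_smul]⟩
  have hau : ‖a‖ = ‖b‖ * ‖u‖ := by
    conv_lhs => rw [hu]
    rw [norm_smul, norm_norm]
  have hu1 : ‖u‖ ≤ 1 := by
    rw [hau] at hab
    exact le_of_mul_le_mul_left (by linarith) hR
  generalize ‖a‖ = A at *
  generalize ‖b‖ = B at *
  generalize ‖c‖ = C at *
  generalize ‖d‖ = D at *
  have h₁ := norm_smul_sub_smul_unit_le hR.le le_rfl le_rfl hu1 hv.le
  have h₂ := norm_smul_sub_smul_unit_le hR.le le_rfl hbc hu1 hw.le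
  have h₃ := norm_smul_sub_smul_unit_le hR.le le_rfl hbd hu1 hx.le
  have h₄ := norm_smul_sub_smul_unit_le hR.le le_rfl hbc hv.le hw.le
  have h₅ := norm_smul_sub_smul_unit_le hR.le le_rfl hbd hv.le hx.le
  have h₆ := norm_smul_sub_smul_unit_le hR.le hbc hbd hw.le hx.le
  rw [← hu] at h₁ h₂ h₃
  rw [← hbv] at h₁ h₄ h₅
  rw [← hcw] at h₂ h₄ h₆
  rw [← hdx] at h₃ h₅ h₆
  by_contra! h
  obtain ⟨k₁, k₂, k₃, k₄, k₅, k₆⟩ := h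
  -- The averages have weights 1/3, 1/3, 1/6, 1/6 on the first four orders, or 1/4 on each of the
  -- last four. In both, `c` and `d` are path ends half of the time, so their mean degree is 3/2 and
  -- their excess radii cost exactly the allowed 3/2.
  rcases path_average_unit_le hu1 hv hw hx with hm | hm <;>
  · have := mul_le_mul_of_nonneg_left hm hR.le
    linarith

end Geometry

/-! ### Consecutive pairs in a list. -/

section ConsecutivePairs

variable {V : Type*}

/-- The list of the edges between consecutive vertices of a list. -/
def consecutiveEdges : List V → List (Sym2 V)
  | [] => []
  | [_] => []
  | u :: v :: l => s(u, v) :: consecutiveEdges (v :: l)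

theorem pair_infix_cons_cons {a b u v : V} {l : List V} :
    [a, b] <:+: u :: v :: l ↔ (a = u ∧ b = v) ∨ [a, b] <:+: v :: l := by
  rw [List.infix_cons_iff]
  simp [List.cons_prefix_cons]

theorem not_pair_infix_singleton {a b u : V} : ¬ [a, b] <:+: [u] := fun h => by
  simpa using h.length_le

theorem mem_consecutiveEdges_of_infix {a b : V} {l : List V} (h : [a, b] <:+: l) :
    s(a, b) ∈ consecutiveEdges l := by
  fun_induction consecutiveEdges l with
  | case1 => simpa using h.length_le
  | case2 => exact (not_pair_infix_singleton h).elim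
  | case3 u v l ih =>
    rcases pair_infix_cons_cons.1 h with ⟨rfl, rfl⟩ | h
    · simp
    · exact List.mem_cons_of_mem _ (ih h)

theorem length_consecutiveEdges_cons (v : V) (l : List V) :
    (consecutiveEdges (v :: l)).length = l.length := by
  induction l generalizing v with
  | nil => rfl
  | cons w l ih => simp [consecutiveEdges, ih]

theorem pathWeight_eq_sum_consecutiveEdges [MetricSpace V] (l : List V) :
    pathWeight l = ((consecutiveEdges l).map
      (Sym2.lift ⟨fun u v : V => dist u v, fun u v => dist_comm u v⟩)).sum := by
  fun_induction consecutiveEdges l with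
  | case1 => simp [pathWeight]
  | case2 => simp [pathWeight]
  | case3 u v l ih => simp [pathWeight, ih]

theorem fst_mem_of_pair_infix {a b : V} {l : List V} (h : [a, b] <:+: l) : a ∈ l :=
  h.subset (by simp)

theorem snd_mem_of_pair_infix_cons {a b v : V} {l : List V} (h : [a, b] <:+: v :: l) : b ∈ l := by
  induction l generalizing v with
  | nil => exact (not_pair_infix_singleton h).elim
  | cons w l ih =>
    rcases pair_infix_cons_cons.1 h with ⟨rfl, rfl⟩ | h
    · simp
    · exact List.mem_cons_of_mem _ (ih h)

theorem eq_of_pair_infix_left {a b c : V} {l : List V} (hl : l.Nodup) (hb : [a, b] <:+: l)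
    (hc : [a, c] <:+: l) : b = c := by
  induction l with
  | nil => simpa using hb.length_le
  | cons u l ih =>
    cases l with
    | nil => exact (not_pair_infix_singleton hb).elim
    | cons v l =>
      have hu : u ∉ v :: l := (List.nodup_cons.1 hl).1
      rcases pair_infix_cons_cons.1 hb with ⟨rfl, rfl⟩ | hb <;>
        rcases pair_infix_cons_cons.1 hc with ⟨h, rfl⟩ | hc
      · rfl
      · exact (hu (fst_mem_of_pair_infix hc)).elim
      · exact (hu (h ▸ fst_mem_of_pair_infix hb)).elim
      · exact ih hl.of_cons hb hc

theorem eq_of_pair_infix_right {a b c : V} {l : List V} (hl : l.Nodup) (hb : [b, a] <:+: l)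
    (hc : [c, a] <:+: l) : b = c := by
  refine eq_of_pair_infix_left (List.nodup_reverse.2 hl) (a := a) ?_ ?_
  · simpa using List.reverse_infix.2 hb
  · simpa using List.reverse_infix.2 hc

end ConsecutivePairs

/-! ### Shortest visiting paths and the local 3/2 bound. -/

section ShortPaths

variable {V : Type*} {v : V} {C : Finset V} {l : List V}

theorem isPathVisiting_iff_perm (hv : v ∉ C) : IsPathVisiting v C l ↔ l.Perm C.toList := by
  constructor
  · rintro ⟨h, hm⟩
    exact (List.perm_ext_iff_of_nodup h.of_cons C.nodup_toList).2 (by simpa using hm)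
  · intro h
    have hm : ∀ w, w ∈ l ↔ w ∈ C := by simp [h.mem_iff]
    exact ⟨List.nodup_cons.2 ⟨by rwa [hm], h.nodup_iff.2 C.nodup_toList⟩, hm⟩

theorem IsPathVisiting.length_eq (h : IsPathVisiting v C l) : l.length = C.card := by
  classical
  rw [← List.toFinset_card_of_nodup h.1.of_cons]
  congr 1
  ext w
  simpa using h.2 w

theorem exists_isShortestPathVisiting [MetricSpace V] (hv : v ∉ C) :
    ∃ l, IsShortestPathVisiting v C l := by
  classical
  obtain ⟨l, hl, hmin⟩ := C.toList.permutations.toFinset.exists_min_image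
    (fun l => pathWeight (v :: l)) ⟨C.toList, by simp⟩
  refine ⟨l, (isPathVisiting_iff_perm hv).2 (by simpa using hl), fun l' hl' => hmin l' ?_⟩
  simpa using (isPathVisiting_iff_perm hv).1 hl'

theorem exists_perm_pairwise_dist_le [MetricSpace V] (v : V) (C : Finset V) :
    ∃ l : List V, l.Perm C.toList ∧ l.Pairwise fun x y => dist v x ≤ dist v y := by
  classical
  let r : V → V → Prop := fun x y => dist v x ≤ dist v y
  have : Std.Total r := ⟨fun x y => le_total _ _⟩
  have : IsTrans V r := ⟨fun x y z => le_trans⟩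
  exact ⟨C.toList.insertionSort r, List.perm_insertionSort r _, List.pairwise_insertionSort r _⟩

theorem exists_pathWeight_le {E : Type*} [NormedAddCommGroup E] [InnerProductSpace ℝ E]
    {S : Finset E} {v : S} {C : Finset S} (hv : v ∉ C) (hC : C.card ≤ 4) :
    ∃ l, IsPathVisiting v C l ∧ pathWeight (v :: l) ≤ 3 / 2 * ∑ w ∈ C, dist v w := by
  obtain ⟨l, hl, hs⟩ := exists_perm_pairwise_dist_le v C
  have hd (x y : S) : dist x y = ‖((x : E) - v) - (y - v)‖ := by
    rw [sub_sub_sub_cancel_right, ← dist_eq_norm]; rfl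
  have hd' (x : S) : dist v x = ‖(x : E) - v‖ := by
    rw [dist_comm, ← dist_eq_norm]; rfl
  have hpos (x : S) (hx : x ∈ l) : 0 < ‖(x : E) - v‖ := by
    rw [← hd', dist_pos]
    rintro rfl
    exact hv (by simpa [hl.mem_iff] using hx)
  have hsum : ∑ w ∈ C, dist v w = (l.map fun w : S => ‖(w : E) - v‖).sum := by
    rw [(hl.map _).sum_eq, Finset.sum_map_toList]
    exact Finset.sum_congr rfl fun w _ => hd' w
  have hlen : l.length ≤ 4 := by rwa [hl.length_eq, Finset.length_toList]
  suffices h : ∃ l', l'.Perm l ∧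
      pathWeight (v :: l') ≤ 3 / 2 * (l.map fun w : S => ‖(w : E) - v‖).sum by
    obtain ⟨l', hl', h⟩ := h
    exact ⟨l', (isPathVisiting_iff_perm hv).2 (hl'.trans hl), hsum ▸ h⟩
  simp only [hd'] at hs
  clear hsum hl hC
  match l, hlen with
  | [], _ => exact ⟨[], .refl _, by simp [pathWeight]⟩
  | [a], _ =>
    refine ⟨[a], .refl _, ?_⟩
    have := hpos a (by simp)
    simp only [pathWeight, List.map, List.sum_cons, List.sum_nil, hd']
    linarith
  | [a, b], _ =>
    refine ⟨[a, b], .refl _, ?_⟩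
    have h := norm_sub_le ((a : E) - v) (b - v)
    simp only [List.pairwise_cons, List.mem_cons, forall_eq_or_imp] at hs
    simp only [pathWeight, List.map, List.sum_cons, List.sum_nil, hd', hd a b]
    linarith [hs.1.1]
  | [a, b, c], _ =>
    simp only [List.pairwise_cons, List.mem_cons, forall_eq_or_imp] at hs
    rcases exists_short_path_three (hpos a (by simp)) hs.1.1 hs.2.1.1 with h | h | h
    · refine ⟨[a, b, c], .refl _, ?_⟩
      simp only [pathWeight, List.map, List.sum_cons, List.sum_nil, hd', hd a b, hd b c]
      linarith
    · refine ⟨[a, c, b], .cons _ (.swap _ _ _), ?_⟩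
      simp only [pathWeight, List.map, List.sum_cons, List.sum_nil, hd', dist_comm c b, hd a c,
        hd b c]
      linarith
    · refine ⟨[b, a, c], .swap _ _ _, ?_⟩
      simp only [pathWeight, List.map, List.sum_cons, List.sum_nil, hd', dist_comm b a, hd a b,
        hd a c]
      linarith
  | [a, b, c, d], _ =>
    simp only [List.pairwise_cons, List.mem_cons, forall_eq_or_imp] at hs
    have hab := hd a b
    have hac := hd a c
    have had := hd a d
    have hbc := hd b c
    have hbd := hd b d
    have hcd := hd c d
    rcases exists_short_path_four (hpos a (by simp)) hs.1.1 hs.2.1.1 hs.2.1.2.1 with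
      h | h | h | h | h | h
    · refine ⟨[a, b, c, d], .refl _, ?_⟩
      simp only [pathWeight, List.map, List.sum_cons, List.sum_nil, hd']
      linarith
    · refine ⟨[a, b, d, c], .cons _ (.cons _ (.swap _ _ _)), ?_⟩
      simp only [pathWeight, List.map, List.sum_cons, List.sum_nil, hd', dist_comm d c]
      linarith
    · refine ⟨[a, c, b, d], .cons _ (.swap _ _ _), ?_⟩
      simp only [pathWeight, List.map, List.sum_cons, List.sum_nil, hd', dist_comm c b]
      linarith
    · refine ⟨[a, d, b, c], .cons _ (.trans (.swap _ _ _) (.cons _ (.swap _ _ _))), ?_⟩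
      simp only [pathWeight, List.map, List.sum_cons, List.sum_nil, hd', dist_comm d b]
      linarith
    · refine ⟨[b, a, c, d], .swap _ _ _, ?_⟩
      simp only [pathWeight, List.map, List.sum_cons, List.sum_nil, hd', dist_comm b a]
      linarith
    · refine ⟨[b, a, d, c], .trans (.swap _ _ _) (.cons _ (.cons _ (.swap _ _ _))), ?_⟩
      simp only [pathWeight, List.map, List.sum_cons, List.sum_nil, hd', dist_comm b a,
        dist_comm d c]
      linarith

end ShortPaths

/-! ### Parents and children in a rooted tree. -/

section RootedTrees

variable {V : Type*} [Fintype V] {T : SimpleGraph V} {r u v w : V}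

theorem mem_children : w ∈ children T r v ↔ T.Adj v w ∧ T.dist r w = T.dist r v + 1 := by
  simp [children]

theorem notMem_children_self : v ∉ children T r v := fun h =>
  T.loopless.irrefl v (mem_children.1 h).1

theorem SimpleGraph.Connected.exists_mem_children (hT : T.Connected) (hv : v ≠ r) :
    ∃ u, v ∈ children T r u := by
  obtain ⟨p, hp⟩ := hT.exists_walk_length_eq_dist r v
  have hnil : ¬ p.Nil := fun h => hv h.eq.symm
  refine ⟨p.penultimate, mem_children.2 ⟨p.adj_penultimate hnil, ?_⟩⟩
  have h₁ := SimpleGraph.dist_le p.dropLast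
  have h₂ := hT.dist_triangle (u := r) (v := p.penultimate) (w := v)
  have h₃ := SimpleGraph.dist_eq_one_iff_adj.2 (p.adj_penultimate hnil)
  have h₄ : p.dropLast.length + 1 = p.length := by
    have := SimpleGraph.Walk.not_nil_iff_lt_length.1 hnil
    rw [SimpleGraph.Walk.length_dropLast]
    omega
  omega

/-- The parent must be the penultimate vertex of the unique path from the root: a shortest path to a
parent cannot pass through its child, which is further away. -/
theorem SimpleGraph.IsTree.eq_of_mem_children (hT : T.IsTree) (hu : w ∈ children T r u)
    (hv : w ∈ children T r v) : u = v := by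
  obtain ⟨p, hp, hl⟩ := hT.connected.exists_path_of_dist r w
  have key : ∀ u, w ∈ children T r u → u = p.penultimate := fun u hu => by
    obtain ⟨hadj, hd⟩ := mem_children.1 hu
    refine hT.isAcyclic.eq_penultimate_of_adj_end hp hadj.symm ?_
    obtain ⟨q, hq, hlq⟩ := hT.connected.exists_path_of_dist r u
    refine hT.isAcyclic.mem_support_of_ne_mem_support_of_adj_of_isPath hp hq hadj.symm
      fun hmem => ?_
    classical
    have h₁ := SimpleGraph.dist_le (q.takeUntil w hmem)
    have h₂ := q.length_takeUntil_le_length hmem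
    omega
  rw [key u hu, key v hv]

theorem SimpleGraph.Connected.card_children_le {k : ℕ} (hT : T.Connected)
    (hdeg : (T.neighborSet v).ncard ≤ k + 1) (hr : (T.neighborSet r).ncard ≤ k) :
    (children T r v).card ≤ k := by
  classical
  rw [← Set.ncard_coe_finset]
  by_cases hv : v = r
  · subst hv
    exact (Set.ncard_le_ncard (fun w hw => (mem_children.1 hw).1) (Set.toFinite _)).trans hr
  · obtain ⟨u, hu⟩ := hT.exists_mem_children hv
    obtain ⟨hadj, hd⟩ := mem_children.1 hu
    have hsub : (children T r v : Set V) ⊆ T.neighborSet v \ {u} := by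
      intro w hw
      have hw := mem_children.1 (Finset.mem_coe.1 hw)
      refine ⟨hw.1, ?_⟩
      rintro rfl
      omega
    have h₁ := Set.ncard_le_ncard hsub (Set.toFinite _)
    rw [Set.ncard_sdiff_singleton_of_mem (show u ∈ T.neighborSet v from hadj.symm)] at h₁
    omega

open Classical in
/-- Distinct pairs of a parent and its child are distinct edges. -/
theorem sum_children_le_sum_edgeFinset (T : SimpleGraph V) (r : V) (f : Sym2 V → ℝ)
    (hf : ∀ e, 0 ≤ f e) :
    ∑ v, ∑ w ∈ children T r v, f s(v, w) ≤ ∑ e ∈ T.edgeFinset, f e := by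
  rw [Finset.sum_sigma' Finset.univ (fun v => children T r v) fun v w => f s(v, w)]
  rw [← Finset.sum_image (f := f)
    (g := fun x : (_ : V) × V => s(x.1, x.2)) (s := Finset.univ.sigma fun v => children T r v)]
  · refine Finset.sum_le_sum_of_subset_of_nonneg ?_ fun e _ _ => hf e
    intro e he
    obtain ⟨⟨v, w⟩, hx, rfl⟩ := Finset.mem_image.1 he
    rw [SimpleGraph.mem_edgeFinset, SimpleGraph.mem_edgeSet]
    exact (mem_children.1 (Finset.mem_sigma.1 hx).2).1
  · rintro ⟨v, w⟩ hx ⟨v', w'⟩ hy h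
    have h₁ := (mem_children.1 (Finset.mem_sigma.1 hx).2).2
    have h₂ := (mem_children.1 (Finset.mem_sigma.1 hy).2).2
    dsimp only at h h₁ h₂
    rcases Sym2.eq_iff.1 h with ⟨rfl, rfl⟩ | ⟨rfl, rfl⟩
    · rfl
    · omega

end RootedTrees

/-! ### The union of the paths: tree, degrees, weight. -/

section UnionOfPaths

variable {V : Type*} {P : V → List V}

theorem unionOfPaths_adj {a b : V} : (unionOfPaths P).Adj a b ↔
    a ≠ b ∧ ((∃ v, [a, b] <:+: v :: P v) ∨ ∃ v, [b, a] <:+: v :: P v) :=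
  SimpleGraph.fromRel_adj _ _ _

theorem reachable_of_mem_cons (G : SimpleGraph V) {v : V} {l : List V}
    (hG : ∀ a b, [a, b] <:+: v :: l → a ≠ b → G.Adj a b) : ∀ w ∈ l, G.Reachable v w := by
  induction l generalizing v with
  | nil => simp
  | cons x l ih =>
    have hx : G.Reachable v x := by
      by_cases h : v = x
      · rw [h]
      · exact (hG v x (pair_infix_cons_cons.2 (.inl ⟨rfl, rfl⟩)) h).reachable
    intro w hw
    rcases List.mem_cons.1 hw with rfl | hw
    · exact hx
    · exact hx.trans (ih (fun a b hab => hG a b (pair_infix_cons_cons.2 (.inr hab))) w hw)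

theorem reachable_unionOfPaths {v w : V} (hw : w ∈ P v) : (unionOfPaths P).Reachable v w :=
  reachable_of_mem_cons _ (fun _ _ h hne => unionOfPaths_adj.2 ⟨hne, .inl ⟨v, h⟩⟩) w hw

variable [Fintype V] {T : SimpleGraph V} {r : V}

open Classical in
theorem sum_edgeFinset_unionOfPaths_le (P : V → List V) (f : Sym2 V → ℝ) (hf : ∀ e, 0 ≤ f e) :
    ∑ e ∈ (unionOfPaths P).edgeFinset, f e ≤ ∑ v, ((consecutiveEdges (v :: P v)).map f).sum := by
  have hle : (unionOfPaths P).edgeFinset.val ≤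
      ∑ v, (consecutiveEdges (v :: P v) : Multiset (Sym2 V)) := by
    -- The edges of the union are listed without repetition, so containment needs no count of
    -- multiplicities.
    rw [Multiset.le_iff_subset (Finset.nodup _)]
    intro e he
    rw [Finset.mem_val, SimpleGraph.mem_edgeFinset] at he
    rw [Multiset.mem_sum]
    induction e with
    | h a b =>
      rw [SimpleGraph.mem_edgeSet, unionOfPaths_adj] at he
      rcases he.2 with ⟨v, h⟩ | ⟨v, h⟩
      · exact ⟨v, Finset.mem_univ v, mem_consecutiveEdges_of_infix h⟩
      · exact ⟨v, Finset.mem_univ v, Sym2.eq_swap ▸ mem_consecutiveEdges_of_infix h⟩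
  obtain ⟨t, ht⟩ := Multiset.le_iff_exists_add.1 hle
  have hsum : ∑ v, ((consecutiveEdges (v :: P v)).map f).sum =
      ((∑ v, (consecutiveEdges (v :: P v) : Multiset (Sym2 V))).map f).sum := by
    have := map_sum (Multiset.sumAddMonoidHom.comp (Multiset.mapAddMonoidHom f))
      (fun v => (consecutiveEdges (v :: P v) : Multiset (Sym2 V))) Finset.univ
    exact this.symm
  rw [hsum, ht, Multiset.map_add, Multiset.sum_add]
  refine le_add_of_nonneg_right (Multiset.sum_nonneg fun x hx => ?_)
  obtain ⟨e, -, rfl⟩ := Multiset.mem_map.1 hx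
  exact hf e

theorem connected_unionOfPaths (hT : T.Connected)
    (hP : ∀ v, IsPathVisiting v (children T r v) (P v)) : (unionOfPaths P).Connected := by
  have key : ∀ n v, T.dist r v = n → (unionOfPaths P).Reachable r v := by
    intro n
    induction n with
    | zero =>
      intro v hv
      rw [hT.dist_eq_zero_iff.1 hv]
    | succ n ih =>
      intro v hv
      obtain ⟨u, hu⟩ := hT.exists_mem_children (r := r) (v := v) (by rintro rfl; simp at hv)
      have hd := (mem_children.1 hu).2
      exact (ih u (by omega)).trans (reachable_unionOfPaths (((hP u).2 v).2 hu))
  exact (SimpleGraph.connected_iff _).2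
    ⟨fun a b => (key _ a rfl).symm.trans (key _ b rfl), ⟨r⟩⟩

theorem isTree_unionOfPaths (hT : T.IsTree)
    (hP : ∀ v, IsPathVisiting v (children T r v) (P v)) : (unionOfPaths P).IsTree := by
  classical
  have hconn := connected_unionOfPaths hT.connected hP
  refine SimpleGraph.isTree_iff_connected_and_card.2
    ⟨hconn, le_antisymm ?_ hconn.card_vert_le_card_edgeSet_add_one⟩
  -- With unit weights the two sums count edges: each path has as many as its start has children.
  have h₁ := sum_edgeFinset_unionOfPaths_le P (fun _ => 1) fun _ => zero_le_one
  have h₂ := sum_children_le_sum_edgeFinset T r (fun _ => 1) fun _ => zero_le_one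
  have h₃ (v : V) : ((consecutiveEdges (v :: P v)).map fun _ => (1 : ℝ)).sum =
      (children T r v).card := by
    rw [List.map_const', List.sum_replicate, length_consecutiveEdges_cons, (hP v).length_eq]
    simp
  simp only [h₃, Finset.sum_const, nsmul_eq_mul, mul_one] at h₁ h₂
  have h : (unionOfPaths P).edgeFinset.card ≤ T.edgeFinset.card := by exact_mod_cast h₁.trans h₂
  rw [Nat.card_eq_fintype_card, Nat.card_eq_fintype_card, ← hT.card_edgeFinset,
    ← SimpleGraph.edgeFinset_card]
  exact Nat.add_le_add_right h 1

/-- A vertex has at most one neighbour on its own path, and at most two on that of its parent. -/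
theorem ncard_neighborSet_unionOfPaths_le (hT : T.IsTree)
    (hP : ∀ v, IsPathVisiting v (children T r v) (P v)) (v : V) :
    ((unionOfPaths P).neighborSet v).ncard ≤ 3 := by
  have hnodup u : (u :: P u).Nodup := (hP u).1
  let A : Set V := {w | [v, w] <:+: v :: P v}
  let B : Set V := {w | ∃ u, v ∈ P u ∧ [v, w] <:+: u :: P u}
  let C : Set V := {w | ∃ u, v ∈ P u ∧ [w, v] <:+: u :: P u}
  have hparent {u u' : V} (hu : v ∈ P u) (hu' : v ∈ P u') : u = u' :=
    hT.eq_of_mem_children (((hP u).2 v).1 hu) (((hP u').2 v).1 hu')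
  have hA : A.ncard ≤ 1 := (Set.ncard_le_one_iff (Set.toFinite _)).2
    fun hb hc => eq_of_pair_infix_left (hnodup v) hb hc
  have hB : B.ncard ≤ 1 := by
    refine (Set.ncard_le_one_iff (Set.toFinite _)).2 ?_
    rintro b c ⟨u, hu, hb⟩ ⟨u', hu', hc⟩
    obtain rfl := hparent hu hu'
    exact eq_of_pair_infix_left (hnodup u) hb hc
  have hC : C.ncard ≤ 1 := by
    refine (Set.ncard_le_one_iff (Set.toFinite _)).2 ?_
    rintro b c ⟨u, hu, hb⟩ ⟨u', hu', hc⟩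
    obtain rfl := hparent hu hu'
    exact eq_of_pair_infix_right (hnodup u) hb hc
  have hsub : (unionOfPaths P).neighborSet v ⊆ A ∪ B ∪ C := by
    intro w hw
    rcases (unionOfPaths_adj.1 hw).2 with ⟨u, h⟩ | ⟨u, h⟩
    · rcases List.mem_cons.1 (fst_mem_of_pair_infix h) with rfl | hu
      · exact .inl (.inl h)
      · exact .inl (.inr ⟨u, hu, h⟩)
    · exact .inr ⟨u, snd_mem_of_pair_infix_cons h, h⟩
  have h₁ := Set.ncard_le_ncard hsub (Set.toFinite _)
  have h₂ := Set.ncard_union_le (A ∪ B) C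
  have h₃ := Set.ncard_union_le A B
  omega

theorem graphWeight_unionOfPaths_le [MetricSpace V] {c : ℝ} (hc : 0 ≤ c)
    (hP : ∀ v, pathWeight (v :: P v) ≤ c * ∑ w ∈ children T r v, dist v w) :
    graphWeight (unionOfPaths P) ≤ c * graphWeight T := by
  classical
  have hf : ∀ e : Sym2 V, 0 ≤ Sym2.lift ⟨fun u v : V => dist u v, fun u v => dist_comm u v⟩ e :=
    fun e => e.ind fun _ _ => dist_nonneg
  calc graphWeight (unionOfPaths P) ≤ ∑ v, pathWeight (v :: P v) := by
        simp only [pathWeight_eq_sum_consecutiveEdges]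
        exact sum_edgeFinset_unionOfPaths_le P _ hf
    _ ≤ c * ∑ v, ∑ w ∈ children T r v, dist v w := by
        rw [Finset.mul_sum]
        exact Finset.sum_le_sum fun v _ => hP v
    _ ≤ c * graphWeight T :=
        mul_le_mul_of_nonneg_left (sum_children_le_sum_edgeFinset T r _ hf) hc

end UnionOfPaths

theorem mainTheorem1 (S : Finset (EuclideanSpace ℝ (Fin 2))) (T : SimpleGraph S)
    (hT : IsMinSpanningTree T) :
    (∀ r v : S, (children T r v).card ≤ 4 →
      ∀ l : List S, IsShortestPathVisiting v (children T r v) l →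
        pathWeight (v :: l) ≤ 3 / 2 * ∑ w ∈ children T r v, dist v w) ∧
    ((∀ v : S, (T.neighborSet v).ncard ≤ 5) →
      ∀ r : S, (T.neighborSet r).ncard ≤ 1 →
        (∀ v : S, (children T r v).card ≤ 4) ∧
        (∀ v : S, ∃ l : List S, IsShortestPathVisiting v (children T r v) l) ∧
        ∀ P : S → List S, (∀ v : S, IsShortestPathVisiting v (children T r v) (P v)) →
          (unionOfPaths P).IsTree ∧
          (∀ v : S, ((unionOfPaths P).neighborSet v).ncard ≤ 3) ∧
          graphWeight (unionOfPaths P) ≤ 3 / 2 * graphWeight T) := by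
  have short : ∀ r v : S, (children T r v).card ≤ 4 →
      ∀ l : List S, IsShortestPathVisiting v (children T r v) l →
        pathWeight (v :: l) ≤ 3 / 2 * ∑ w ∈ children T r v, dist v w := by
    intro r v hcard l hl
    obtain ⟨l', hl', h⟩ := exists_pathWeight_le notMem_children_self hcard
    exact (hl.2 l' hl').trans h
  refine ⟨short, fun hdeg r hr => ?_⟩
  have hcard (v : S) : (children T r v).card ≤ 4 :=
    hT.1.connected.card_children_le (hdeg v) (hr.trans (by norm_num))
  refine ⟨hcard, fun v => exists_isShortestPathVisiting notMem_children_self, fun P hP => ?_⟩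
  exact ⟨isTree_unionOfPaths hT.1 fun v => (hP v).1,
    ncard_neighborSet_unionOfPaths_le hT.1 fun v => (hP v).1,
    graphWeight_unionOfPaths_le (by norm_num) fun v => short r v (hcard v) _ (hP v)⟩
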